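/- Let $n\ge 2$ and let $$\Delta=\bigcap_{i=1}^n\{w\in\mathbb R^2 \mid \langle w,v_i\rangle\ge a_i\}$$ be a Delzant polyhedral set, where $v_i=(\alpha_i,\beta_i)\in\mathbb Z^2$ are the primitive inward-pointing normal vectors, ordered counter-clockwise from $v_1=(1,0)$ to $v_n=(0,1)$, $a_i\in\mathbb R$, $a_1=a_n=0$, every $v_i$ defines a non-degenerate edge of $\Delta$, and $v_i,v_{i+1}$ is a basis of $\mathbb Z^2$ for $1\le i<n$. Let $K$ be the kernel of the homomorphism $(S^1)^n\to(S^1)^2$ induced by $e_i\mapsto v_i$, let $$U_\Delta=\{x\in\mathbb C^n \mid \tfrac12(\alpha_i|x_1|^2-|x_i|^2+\beta_i|x_n|^2)=a_i \text{ for all } 1<i<n\},$$ and let $N=M_\Delta=U_\Delta/K$ be the symplectic reduction of $\mathbb C^n$ (with its standard symplectic form) by $K$, with its quotient smooth structure and reduced symplectic form, with the action of $(S^1)^2\cong(S^1)^n/K$ given by $(\lambda_1,\lambda_2)\cdot[x_1,\dots,x_n]=[\lambda_1x_1,x_2,\dots,x_{n-1},\lambda_2x_n]$ and the moment map $\Phi([x])=\frac12(|x_1|^2,|x_n|^2)$.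 Let $D=\bigcup_{1<i<n}\{p\in N\mid \langle\Phi(p),v_i\rangle=a_i\}$ be the chain of isotropy spheres. Then the map $$\psi\colon N\smallsetminus D\to\bigcap_{i=2}^{n-1}\Big\{z\in\mathbb C^2\ \Big|\ \tfrac12\big\langle(|z_1|^2,|z_2|^2),v_i\big\rangle>a_i\Big\},$$ $$[x_1,\dots,x_n]\mapsto\left(\frac{x_1x_2^{\alpha_2}\cdots x_{n-1}^{\alpha_{n-1}}}{|x_2^{\alpha_2}\cdots x_{n-1}^{\alpha_{n-1}}|},\ \frac{x_2^{\beta_2}\cdots x_{n-1}^{\beta_{n-1}}x_n}{|x_2^{\beta_2}\cdots x_{n-1}^{\beta_{n-1}}|}\right)$$ is a well-defined $(S^1)^2$-equivariant symplectomorphism (a diffeomorphism onto the stated open set that preserves the symplectic forms) that intertwines the moment maps. Here $\mathbb C^2$ carries the standard symplectic form, the standard $(S^1)^2$-action, and the homogeneous moment map $z\mapsto\frac12(|z_1|^2,|z_2|^2)$. -/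

import Mathlib

open Set Filter Topology
open scoped Manifold ContDiff

noncomputable section

/-- Combinatorial data of a Delzant polyhedral set
`{w ∈ ℝ² | ∀ i, ⟨w, vᵢ⟩ ≥ aᵢ}` with `n = m + 2` edges, where `vᵢ = (αᵢ, βᵢ)`.  The indices
`1, …, n` are `0, …, m + 1 : Fin (m + 2)`. -/
structure DelzantCorner (m : ℕ) where
  /-- first coordinate of the normal vector `vᵢ` -/
  α : Fin (m + 2) → ℤ
  /-- second coordinate of the normal vector `vᵢ` -/
  β : Fin (m + 2) → ℤ
  /-- support constants -/
  a : Fin (m + 2) → ℝ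
  α_first : α 0 = 1
  β_first : β 0 = 0
  α_last : α (Fin.last (m + 1)) = 0
  β_last : β (Fin.last (m + 1)) = 1
  a_first : a 0 = 0
  a_last : a (Fin.last (m + 1)) = 0
  /-- every normal vector is primitive -/
  primitive : ∀ i, IsCoprime (α i) (β i)
  /-- the normal vectors are ordered counter-clockwise, from `(1, 0)` to `(0, 1)` -/
  ccw : ∀ i j, i < j → 0 < α i * β j - β i * α j
  /-- Delzant condition: the normals of adjacent edges form a basis of `ℤ²` -/
  delzant : ∀ i : Fin (m + 1),
    IsUnit (α i.castSucc * β i.succ - β i.castSucc * α i.succ)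
  /-- each `vᵢ` defines a non-degenerate edge: the `i`-th face has more than one point -/
  edge_nontrivial : ∀ i, {w : ℝ × ℝ | (∀ k, a k ≤ α k * w.1 + β k * w.2) ∧
    α i * w.1 + β i * w.2 = a i}.Nontrivial

namespace DelzantCorner

variable {m : ℕ} (Δ : DelzantCorner m)

/-- The index of an interior edge: one different from the first and the last. -/
def mid (i : Fin m) : Fin (m + 2) := i.castSucc.succ

/-- The homomorphism `(S¹)ⁿ → (S¹)²` induced by `ℝⁿ → ℝ²`, `eᵢ ↦ vᵢ`. -/
def torusHom : (Fin (m + 2) → Circle) →* Circle × Circle where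
  toFun t := (∏ i, t i ^ Δ.α i, ∏ i, t i ^ Δ.β i)
  map_one' := by simp
  map_mul' s t := by simp [mul_zpow, Finset.prod_mul_distrib]

/-- The kernel `K` of `(S¹)ⁿ → (S¹)²`. -/
def K : Subgroup (Fin (m + 2) → Circle) := Δ.torusHom.ker

/-- The level set of the moment map for the action of `K` on `ℂⁿ`. -/
def levelSet : Set (Fin (m + 2) → ℂ) :=
  {x | ∀ i : Fin m, (1 / 2 : ℝ) * (Δ.α (mid i) * ‖x 0‖ ^ 2 - ‖x (mid i)‖ ^ 2
    + Δ.β (mid i) * ‖x (Fin.last (m + 1))‖ ^ 2) = Δ.a (mid i)}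

theorem forall_index {P : Fin (m + 2) → Prop} (h0 : P 0) (h1 : P (Fin.last (m + 1)))
    (h : ∀ i, P (mid i)) (k : Fin (m + 2)) : P k := by
  refine Fin.cases h0 (fun k => ?_) k
  exact Fin.lastCases (by simpa using h1) (fun i => h i) k

theorem level_eq {x : Fin (m + 2) → ℂ} (hx : x ∈ Δ.levelSet) (k : Fin (m + 2)) :
    ‖x k‖ ^ 2 = Δ.α k * ‖x 0‖ ^ 2 + Δ.β k * ‖x (Fin.last (m + 1))‖ ^ 2 - 2 * Δ.a k := by
  refine forall_index (P := fun k => ‖x k‖ ^ 2 = Δ.α k * ‖x 0‖ ^ 2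
    + Δ.β k * ‖x (Fin.last (m + 1))‖ ^ 2 - 2 * Δ.a k) ?_ ?_ ?_ k
  · simp [Δ.α_first, Δ.β_first, Δ.a_first]
  · simp [Δ.α_last, Δ.β_last, Δ.a_last]
  · intro i
    have := hx i
    linarith

theorem mem_levelSet_of {x : Fin (m + 2) → ℂ} (w : ℝ × ℝ)
    (h : ∀ k, ‖x k‖ ^ 2 = 2 * (Δ.α k * w.1 + Δ.β k * w.2 - Δ.a k)) : x ∈ Δ.levelSet := by
  intro i
  have h0 := h 0
  have h1 := h (Fin.last (m + 1))
  simp only [Δ.α_first, Δ.β_first, Δ.a_first, Δ.α_last, Δ.β_last, Δ.a_last] at h0 h1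
  rw [h (mid i), h0, h1]
  push_cast
  ring

/-- `K` acts on the level set by coordinatewise multiplication. -/
instance : MulAction Δ.K Δ.levelSet where
  smul t x := ⟨fun i => (t.1 i : ℂ) * x.1 i, fun i => by simpa [Circle.norm_coe] using x.2 i⟩
  one_smul x := by
    apply Subtype.ext; funext i
    exact one_mul (x.1 i)
  mul_smul s t x := by
    apply Subtype.ext; funext i
    exact mul_assoc (s.1 i : ℂ) (t.1 i : ℂ) (x.1 i)

theorem smul_apply (t : Δ.K) (x : Δ.levelSet) (i : Fin (m + 2)) :
    (t • x).1 i = (t.1 i : ℂ) * x.1 i := rfl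

instance : ContinuousConstSMul Δ.K Δ.levelSet where
  continuous_const_smul t := by
    refine Continuous.subtype_mk (continuous_pi fun i => ?_) _
    exact continuous_const.mul ((continuous_apply i).comp continuous_subtype_val)

/-- The reduced space `M_Δ = (level set) / K`. -/
def ReducedSpace : Type := MulAction.orbitRel.Quotient Δ.K Δ.levelSet

/-- `M_Δ` carries the quotient topology. -/
instance : TopologicalSpace Δ.ReducedSpace :=
  inferInstanceAs (TopologicalSpace (Quotient (MulAction.orbitRel Δ.K Δ.levelSet)))

/-- The quotient map `x ↦ [x]`. -/
def proj (x : Δ.levelSet) : Δ.ReducedSpace := Quotient.mk (MulAction.orbitRel Δ.K Δ.levelSet) x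

theorem isOpenQuotientMap_proj : IsOpenQuotientMap Δ.proj :=
  MulAction.isOpenQuotientMap_quotientMk

theorem proj_eq_proj {x y : Δ.levelSet} : Δ.proj x = Δ.proj y ↔ ∃ t : Δ.K, t • y = x :=
  Quotient.eq (r := MulAction.orbitRel Δ.K Δ.levelSet)

theorem proj_smul (t : Δ.K) (x : Δ.levelSet) : Δ.proj (t • x) = Δ.proj x :=
  Δ.proj_eq_proj.2 ⟨t, rfl⟩

/-- A function on the level set that is invariant under `K` descends to `M_Δ`. -/
def lift {X : Type*} (f : Δ.levelSet → X) (hf : ∀ (t : Δ.K) x, f (t • x) = f x) :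
    Δ.ReducedSpace → X :=
  Quotient.lift f (by rintro _ y ⟨t, rfl⟩; exact hf t y)

@[simp] theorem lift_proj {X : Type*} (f : Δ.levelSet → X) (hf) (x : Δ.levelSet) :
    Δ.lift f hf (Δ.proj x) = f x := rfl

/-! ### Residual torus action, moment map and the chain of spheres -/

/-- The residual moment map `[x] ↦ ½ (|x₁|², |xₙ|²)`. -/
def momentMap : Δ.ReducedSpace → ℝ × ℝ :=
  Δ.lift (fun x => ((1 / 2 : ℝ) * ‖x.1 0‖ ^ 2, (1 / 2 : ℝ) * ‖x.1 (Fin.last (m + 1))‖ ^ 2))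
    (fun t x => by simp [smul_apply, Circle.norm_coe])

theorem continuous_momentMap : Continuous Δ.momentMap := by
  refine Δ.isOpenQuotientMap_proj.isQuotientMap.continuous_iff.2 ?_
  change Continuous fun x : Δ.levelSet =>
    ((1 / 2 : ℝ) * ‖x.1 0‖ ^ 2, (1 / 2 : ℝ) * ‖x.1 (Fin.last (m + 1))‖ ^ 2)
  have h (i : Fin (m + 2)) : Continuous fun x : Δ.levelSet => x.1 i :=
    (continuous_apply i).comp continuous_subtype_val
  exact (continuous_const.mul ((h 0).norm.pow 2)).prodMk
    (continuous_const.mul ((h (Fin.last (m + 1))).norm.pow 2))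

/-- Multiply the first coordinate by `t₁` and the last one by `t₂`. -/
def torusMul (t : Circle × Circle) (x : Δ.levelSet) : Δ.levelSet :=
  ⟨fun i => if i = 0 then (t.1 : ℂ) * x.1 i
    else if i = Fin.last (m + 1) then (t.2 : ℂ) * x.1 i else x.1 i, by
    refine Δ.mem_levelSet_of (Δ.momentMap (Δ.proj x)) fun k => ?_
    rw [show ‖(if k = 0 then (t.1 : ℂ) * x.1 k
      else if k = Fin.last (m + 1) then (t.2 : ℂ) * x.1 k else x.1 k)‖ = ‖x.1 k‖ by
        split_ifs <;> simp [Circle.norm_coe], Δ.level_eq x.2 k]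
    simp only [momentMap, lift_proj]
    ring⟩

/-- The residual action of `(S¹)² ≅ (S¹)ⁿ / K`:
`(t₁, t₂) • [x₁, …, xₙ] = [t₁ x₁, x₂, …, xₙ₋₁, t₂ xₙ]`. -/
instance : MulAction (Circle × Circle) Δ.ReducedSpace where
  smul t := Δ.lift (fun x => Δ.proj (Δ.torusMul t x)) (fun s x => by
    rw [proj_eq_proj]
    refine ⟨s, Subtype.ext (funext fun i => ?_)⟩
    simp only [smul_apply, torusMul]
    split_ifs <;> ring)
  one_smul p := by
    obtain ⟨x, rfl⟩ := Δ.isOpenQuotientMap_proj.surjective p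
    change Δ.proj (Δ.torusMul 1 x) = Δ.proj x
    congr 1
    apply Subtype.ext; funext i
    simp [torusMul]
  mul_smul s t p := by
    obtain ⟨x, rfl⟩ := Δ.isOpenQuotientMap_proj.surjective p
    change Δ.proj (Δ.torusMul (s * t) x) = Δ.proj (Δ.torusMul s (Δ.torusMul t x))
    congr 1
    apply Subtype.ext; funext i
    simp only [torusMul, Prod.fst_mul, Prod.snd_mul, Circle.coe_mul]
    split_ifs <;> ring

/-- The isotropy sphere `Sᵢ = {p | ⟨Φ(p), vᵢ⟩ = aᵢ}`. -/
def sphere (i : Fin (m + 2)) : Set Δ.ReducedSpace :=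
  {p | Δ.α i * (Δ.momentMap p).1 + Δ.β i * (Δ.momentMap p).2 = Δ.a i}

/-- The chain of isotropy spheres `D = S₂ ∪ ⋯ ∪ Sₙ₋₁`. -/
def chain : Set Δ.ReducedSpace := ⋃ i : Fin m, Δ.sphere (mid i)

/-- The open set `M_Δ ∖ D`. -/
def chainCompl : TopologicalSpace.Opens Δ.ReducedSpace :=
  ⟨Δ.chainᶜ, by
    refine (isClosed_iUnion_of_finite fun i => ?_).isOpen_compl
    have h := Δ.continuous_momentMap
    exact isClosed_eq (by fun_prop) continuous_const⟩

/-- The open subset `⋂_{1<i<n} {z ∈ ℂ² | ½ ⟨(|z₁|², |z₂|²), vᵢ⟩ > aᵢ}` of `ℂ²`. -/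
def blowupTarget : TopologicalSpace.Opens (ℂ × ℂ) :=
  ⟨⋂ i : Fin m, {z | (1 / 2 : ℝ) * (‖z.1‖ ^ 2 * Δ.α (mid i) + ‖z.2‖ ^ 2 * Δ.β (mid i))
      > Δ.a (mid i)}, by
    refine isOpen_iInter_of_finite fun i => ?_
    exact isOpen_lt continuous_const (by fun_prop)⟩

/-! ### Smooth structure of the reduced space -/

/-- A homeomorphism `e` from an open subset of `M_Δ` to an open subset of `ℂ²` belongs to the
smooth structure of the quotient if `e([x])` depends smoothly on `x` (that is, it extends locally
to a smooth function on `ℂⁿ`) and `e⁻¹` lifts locally to a smooth map into the level set. -/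
def IsQuotientChart (e : OpenPartialHomeomorph Δ.ReducedSpace (ℂ × ℂ)) : Prop :=
  (∀ x : Δ.levelSet, Δ.proj x ∈ e.source → ∃ f : (Fin (m + 2) → ℂ) → ℂ × ℂ,
    ContDiffAt ℝ ∞ f x.1 ∧ ∀ᶠ y : Δ.levelSet in 𝓝 x, e (Δ.proj y) = f y.1) ∧
  (∀ z ∈ e.target, ∃ s : ℂ × ℂ → (Fin (m + 2) → ℂ),
    ContDiffAt ℝ ∞ s z ∧ ∀ᶠ z' in 𝓝 z, ∃ h : s z' ∈ Δ.levelSet, Δ.proj ⟨s z', h⟩ = e.symm z')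

/-! ### Existence of charts

For indices `i, j` such that `vᵢ, vⱼ` is an oriented basis of `ℤ²`, a point `[x]` with `x_k ≠ 0`
for all `k ≠ i, j` has a unique representative with `x_k > 0` for all `k ≠ i, j`; its coordinates
`(x_i, x_j)` give a chart. -/

/-- The determinant of `vᵢ, vⱼ`. -/
def det (i j : Fin (m + 2)) : ℤ := Δ.α i * Δ.β j - Δ.β i * Δ.α j

/-- All indices but `i` and `j`. -/
def others (i j : Fin (m + 2)) : Finset (Fin (m + 2)) :=
  Finset.univ.filter fun k => k ≠ i ∧ k ≠ j

theorem mem_others {i j k : Fin (m + 2)} : k ∈ others i j ↔ k ≠ i ∧ k ≠ j := by simp [others]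

theorem prod_others {X : Type*} [CommMonoid X] {i j : Fin (m + 2)} (hij : i ≠ j)
    (f : Fin (m + 2) → X) : ∏ k, f k = f i * f j * ∏ k ∈ others i j, f k := by
  rw [← Finset.mul_prod_erase _ f (Finset.mem_univ i),
    ← Finset.mul_prod_erase _ f (Finset.mem_erase.2 ⟨hij.symm, Finset.mem_univ j⟩), mul_assoc]
  congr 2
  refine Finset.prod_congr ?_ fun _ _ => rfl
  ext k
  simp [mem_others, and_comm]

/-- The formula of the chart on `ℂⁿ`. -/
def chartFun (i j : Fin (m + 2)) (x : Fin (m + 2) → ℂ) : ℂ × ℂ :=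
  (x i * ∏ k ∈ others i j, (x k / (‖x k‖ : ℂ)) ^ Δ.det k j,
    x j * ∏ k ∈ others i j, (x k / (‖x k‖ : ℂ)) ^ Δ.det i k)

/-- The value of `|x_k|²` in terms of the chart at `i, j`. -/
def chartSq (i j k : Fin (m + 2)) (z : ℂ × ℂ) : ℝ :=
  Δ.det k j * (‖z.1‖ ^ 2 + 2 * Δ.a i) + Δ.det i k * (‖z.2‖ ^ 2 + 2 * Δ.a j) - 2 * Δ.a k

/-- The inverse of the chart. -/
def chartInv (i j : Fin (m + 2)) (z : ℂ × ℂ) : Fin (m + 2) → ℂ := fun k =>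
  if k = i then z.1 else if k = j then z.2 else (√(Δ.chartSq i j k z) : ℂ)

/-- The image of the chart. -/
def chartTarget (i j : Fin (m + 2)) : Set (ℂ × ℂ) := {z | ∀ k ∈ others i j, 0 < Δ.chartSq i j k z}

theorem continuous_chartSq (i j k : Fin (m + 2)) : Continuous (Δ.chartSq i j k) := by
  unfold chartSq
  fun_prop

theorem isOpen_chartTarget (i j : Fin (m + 2)) : IsOpen (Δ.chartTarget i j) := by
  have : Δ.chartTarget i j = ⋂ k : Fin (m + 2), {z | k ∈ others i j → 0 < Δ.chartSq i j k z} := by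
    ext z; simp [chartTarget]
  rw [this]
  refine isOpen_iInter_of_finite fun k => ?_
  by_cases hk : k ∈ others i j
  · simpa [hk] using isOpen_lt continuous_const (Δ.continuous_chartSq i j k)
  · simp [hk]

section Chart

variable {i j : Fin (m + 2)}

theorem ne_of_det (hd : Δ.det i j = 1) : i ≠ j := by
  rintro rfl
  rw [det, mul_comm, sub_self] at hd
  exact zero_ne_one hd

theorem chartFun_smul (hd : Δ.det i j = 1) (t : Δ.K) (x : Δ.levelSet) :
    Δ.chartFun i j (t • x).1 = Δ.chartFun i j x.1 := by
  have hij := Δ.ne_of_det hd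
  have ht : Δ.torusHom t.1 = 1 := t.2
  have h1 : ∏ k, t.1 k ^ Δ.α k = 1 := congrArg Prod.fst ht
  have h2 : ∏ k, t.1 k ^ Δ.β k = 1 := congrArg Prod.snd ht
  have e1 : t.1 i * ∏ k ∈ others i j, t.1 k ^ Δ.det k j = 1 := by
    have : ∏ k, t.1 k ^ Δ.det k j = 1 := by
      have : ∀ k, t.1 k ^ Δ.det k j
          = (t.1 k ^ Δ.α k) ^ Δ.β j * ((t.1 k ^ Δ.β k) ^ Δ.α j)⁻¹ := fun k => by
        rw [det, zpow_sub, zpow_mul, zpow_mul]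
      simp only [this, Finset.prod_mul_distrib, Finset.prod_inv_distrib, Finset.prod_zpow, h1, h2]
      simp
    rw [prod_others hij, hd, show Δ.det j j = 0 by rw [det]; ring] at this
    simpa using this
  have e2 : t.1 j * ∏ k ∈ others i j, t.1 k ^ Δ.det i k = 1 := by
    have : ∏ k, t.1 k ^ Δ.det i k = 1 := by
      have : ∀ k, t.1 k ^ Δ.det i k
          = (t.1 k ^ Δ.β k) ^ Δ.α i * ((t.1 k ^ Δ.α k) ^ Δ.β i)⁻¹ := fun k => by
        rw [det, zpow_sub, mul_comm (Δ.α i), zpow_mul, mul_comm (Δ.β i), zpow_mul]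
      simp only [this, Finset.prod_mul_distrib, Finset.prod_inv_distrib, Finset.prod_zpow, h1, h2]
      simp
    rw [prod_others hij, hd, show Δ.det i i = 0 by rw [det]; ring] at this
    simpa using this
  have c1 := congrArg (Subtype.val : Circle → ℂ) e1
  have c2 := congrArg (Subtype.val : Circle → ℂ) e2
  have hc (f : Fin (m + 2) → Circle) :
      ((∏ k ∈ others i j, f k : Circle) : ℂ) = ∏ k ∈ others i j, (f k : ℂ) :=
    map_prod Circle.coeHom f _
  simp only [Circle.coe_mul, hc, Circle.coe_zpow, Circle.coe_one] at c1 c2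
  have hp (e : Fin (m + 2) → ℤ) : ∏ k ∈ others i j, ((t • x).1 k / (‖(t • x).1 k‖ : ℂ)) ^ e k
      = (∏ k ∈ others i j, (t.1 k : ℂ) ^ e k) *
        ∏ k ∈ others i j, (x.1 k / (‖x.1 k‖ : ℂ)) ^ e k := by
    rw [← Finset.prod_mul_distrib]
    refine Finset.prod_congr rfl fun k _ => ?_
    rw [smul_apply, norm_mul, Circle.norm_coe, one_mul, mul_div_assoc, mul_zpow]
  unfold chartFun
  rw [hp, hp, smul_apply, smul_apply]
  ext1
  · linear_combination (x.1 i * ∏ k ∈ others i j, (x.1 k / (‖x.1 k‖ : ℂ)) ^ Δ.det k j) * c1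
  · linear_combination (x.1 j * ∏ k ∈ others i j, (x.1 k / (‖x.1 k‖ : ℂ)) ^ Δ.det i k) * c2

theorem chartInv_mem (hd : Δ.det i j = 1) {z : ℂ × ℂ} (hz : z ∈ Δ.chartTarget i j) :
    Δ.chartInv i j z ∈ Δ.levelSet := by
  have hij := Δ.ne_of_det hd
  have hd' : (Δ.α i * Δ.β j - Δ.β i * Δ.α j : ℝ) = 1 := by exact_mod_cast hd
  refine Δ.mem_levelSet_of
    ((‖z.1‖ ^ 2 / 2 + Δ.a i) * Δ.β j - (‖z.2‖ ^ 2 / 2 + Δ.a j) * Δ.β i,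
      (‖z.2‖ ^ 2 / 2 + Δ.a j) * Δ.α i - (‖z.1‖ ^ 2 / 2 + Δ.a i) * Δ.α j) fun k => ?_
  by_cases hi : k = i
  · subst hi
    simp only [chartInv, if_true]
    linear_combination (-‖z.1‖ ^ 2 - 2 * Δ.a k) * hd'
  by_cases hj : k = j
  · subst hj
    simp only [chartInv, hi, if_false, if_true]
    linear_combination (-‖z.2‖ ^ 2 - 2 * Δ.a k) * hd'
  have hk : 0 < Δ.chartSq i j k z := hz k (mem_others.2 ⟨hi, hj⟩)
  simp only [chartInv, hi, hj, if_false, Complex.norm_real, Real.norm_eq_abs, sq_abs,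
    Real.sq_sqrt hk.le]
  simp only [chartSq, det]
  push_cast
  ring

theorem norm_phase {z : ℂ} (hz : z ≠ 0) : ‖z / (‖z‖ : ℂ)‖ = 1 := by
  rw [norm_div, Complex.norm_real, norm_norm, div_self (norm_ne_zero_iff.2 hz)]

theorem norm_chartFun {x : Fin (m + 2) → ℂ} (hx : ∀ k ∈ others i j, x k ≠ 0) :
    ‖(Δ.chartFun i j x).1‖ = ‖x i‖ ∧ ‖(Δ.chartFun i j x).2‖ = ‖x j‖ := by
  have (e : Fin (m + 2) → ℤ) : ‖∏ k ∈ others i j, (x k / (‖x k‖ : ℂ)) ^ e k‖ = 1 := by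
    rw [norm_prod]
    refine Finset.prod_eq_one fun k hk => ?_
    rw [norm_zpow, norm_phase (hx k hk), one_zpow]
  simp only [chartFun, norm_mul, this, mul_one, and_self]

theorem chartSq_chartFun (hd : Δ.det i j = 1) {x : Fin (m + 2) → ℂ} (hxU : x ∈ Δ.levelSet)
    (hx : ∀ k ∈ others i j, x k ≠ 0) (k : Fin (m + 2)) :
    Δ.chartSq i j k (Δ.chartFun i j x) = ‖x k‖ ^ 2 := by
  have hd' : (Δ.α i * Δ.β j - Δ.β i * Δ.α j : ℝ) = 1 := by exact_mod_cast hd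
  rw [chartSq, (Δ.norm_chartFun hx).1, (Δ.norm_chartFun hx).2, Δ.level_eq hxU i,
    Δ.level_eq hxU j, Δ.level_eq hxU k]
  simp only [det]
  push_cast
  linear_combination (Δ.α k * ‖x 0‖ ^ 2 + Δ.β k * ‖x (Fin.last (m + 1))‖ ^ 2) * hd'

theorem chartFun_mem (hd : Δ.det i j = 1) {x : Fin (m + 2) → ℂ} (hxU : x ∈ Δ.levelSet)
    (hx : ∀ k ∈ others i j, x k ≠ 0) : Δ.chartFun i j x ∈ Δ.chartTarget i j := by
  intro k hk
  rw [Δ.chartSq_chartFun hd hxU hx]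
  exact pow_pos (norm_pos_iff.2 (hx k hk)) 2

theorem chartInv_of_mem_others {k : Fin (m + 2)} (hk : k ∈ others i j) (z : ℂ × ℂ) :
    Δ.chartInv i j z k = (√(Δ.chartSq i j k z) : ℂ) := by
  simp [chartInv, mem_others.1 hk]

theorem chartInv_ne_zero {z : ℂ × ℂ} (hz : z ∈ Δ.chartTarget i j) :
    ∀ k ∈ others i j, Δ.chartInv i j z k ≠ 0 := by
  intro k hk
  rw [Δ.chartInv_of_mem_others hk, Complex.ofReal_ne_zero]
  exact (Real.sqrt_pos.2 (hz k hk)).ne'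

theorem chartFun_chartInv (hij : i ≠ j) {z : ℂ × ℂ} (hz : z ∈ Δ.chartTarget i j) :
    Δ.chartFun i j (Δ.chartInv i j z) = z := by
  have (e : Fin (m + 2) → ℤ) :
      ∏ k ∈ others i j, (Δ.chartInv i j z k / (‖Δ.chartInv i j z k‖ : ℂ)) ^ e k = 1 := by
    refine Finset.prod_eq_one fun k hk => ?_
    rw [Δ.chartInv_of_mem_others hk, Complex.norm_real, Real.norm_of_nonneg (Real.sqrt_nonneg _),
      div_self, one_zpow]
    exact Complex.ofReal_ne_zero.2 (Real.sqrt_pos.2 (hz k hk)).ne'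
  simp only [chartFun, this, mul_one]
  simp [chartInv, hij.symm]

/-- The phase of a complex number. -/
def phase (z : ℂ) : Circle := Circle.exp z.arg

theorem coe_phase {z : ℂ} (hz : z ≠ 0) : (phase z : ℂ) = z / (‖z‖ : ℂ) := by
  rw [eq_div_iff (Complex.ofReal_ne_zero.2 (norm_ne_zero_iff.2 hz)), phase, Circle.coe_exp,
    mul_comm, Complex.norm_mul_exp_arg_mul_I]

theorem proj_chartInv_chartFun (hd : Δ.det i j = 1) (x : Δ.levelSet)
    (hx : ∀ k ∈ others i j, x.1 k ≠ 0) :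
    Δ.proj ⟨Δ.chartInv i j (Δ.chartFun i j x.1),
      Δ.chartInv_mem hd (Δ.chartFun_mem hd x.2 hx)⟩ = Δ.proj x := by
  have hij := Δ.ne_of_det hd
  have hc (f : Fin (m + 2) → Circle) :
      ((∏ k ∈ others i j, f k : Circle) : ℂ) = ∏ k ∈ others i j, (f k : ℂ) :=
    map_prod Circle.coeHom f _
  set u : Fin (m + 2) → Circle := fun k => phase (x.1 k) with hu
  have hu' (e : Fin (m + 2) → ℤ) : ((∏ k ∈ others i j, u k ^ e k : Circle) : ℂ)
      = ∏ k ∈ others i j, (x.1 k / (‖x.1 k‖ : ℂ)) ^ e k := by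
    rw [hc]
    refine Finset.prod_congr rfl fun k hk => ?_
    rw [Circle.coe_zpow, hu, coe_phase (hx k hk)]
  set t : Fin (m + 2) → Circle := fun k =>
    if k = i then ∏ k ∈ others i j, u k ^ Δ.det k j
    else if k = j then ∏ k ∈ others i j, u k ^ Δ.det i k else (u k)⁻¹ with ht
  have key (γ : Fin (m + 2) → ℤ) (hγ : ∀ k, Δ.det k j * γ i + Δ.det i k * γ j = γ k) :
      ∏ k, t k ^ γ k = 1 := by
    rw [prod_others hij]
    have ho : ∏ k ∈ others i j, t k ^ γ k = ∏ k ∈ others i j, ((u k)⁻¹) ^ γ k := by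
      refine Finset.prod_congr rfl fun k hk => ?_
      simp [ht, mem_others.1 hk]
    have hi : t i = ∏ k ∈ others i j, u k ^ Δ.det k j := by simp [ht]
    have hj : t j = ∏ k ∈ others i j, u k ^ Δ.det i k := by simp [ht, hij.symm]
    rw [ho, hi, hj, ← Finset.prod_zpow, ← Finset.prod_zpow, ← Finset.prod_mul_distrib,
      ← Finset.prod_mul_distrib]
    refine Finset.prod_eq_one fun k _ => ?_
    rw [← zpow_mul, ← zpow_mul, ← zpow_add, hγ, inv_zpow, mul_inv_cancel]
  have htK : t ∈ Δ.K := by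
    rw [K, MonoidHom.mem_ker]
    refine Prod.ext (key Δ.α fun k => ?_) (key Δ.β fun k => ?_)
    · simp only [det] at hd ⊢
      linear_combination Δ.α k * hd
    · simp only [det] at hd ⊢
      linear_combination Δ.β k * hd
  rw [proj_eq_proj]
  refine ⟨⟨t, htK⟩, Subtype.ext (funext fun k => ?_)⟩
  rw [smul_apply]
  by_cases hi : k = i
  · subst hi
    simp only [ht, chartInv, chartFun, if_true, hu']
    ring
  by_cases hj : k = j
  · subst hj
    simp only [ht, chartInv, chartFun, hi, if_true, if_false, hu']
    ring
  have hk := mem_others.2 ⟨hi, hj⟩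
  have hn : (‖x.1 k‖ : ℂ) ≠ 0 := Complex.ofReal_ne_zero.2 (norm_ne_zero_iff.2 (hx k hk))
  simp only [ht, hi, hj, if_false, Δ.chartInv_of_mem_others hk, Δ.chartSq_chartFun hd x.2 hx,
    Real.sqrt_sq (norm_nonneg _), Circle.coe_inv, hu, coe_phase (hx k hk)]
  rw [inv_div, div_mul_cancel₀ _ (hx k hk)]

/-- The set of `[x]` such that `x_k ≠ 0` for all `k ≠ i, j`. -/
def chartSource (i j : Fin (m + 2)) : Set Δ.ReducedSpace :=
  {p | Δ.lift (fun x => ∀ k ∈ others i j, x.1 k ≠ 0)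
    (fun t x => by simp [smul_apply]) p}

theorem proj_mem_chartSource {x : Δ.levelSet} :
    Δ.proj x ∈ Δ.chartSource i j ↔ ∀ k ∈ others i j, x.1 k ≠ 0 := Iff.rfl

theorem contDiffAt_chartFun {x : Fin (m + 2) → ℂ} (hx : ∀ k ∈ others i j, x k ≠ 0) :
    ContDiffAt ℝ ∞ (Δ.chartFun i j) x := by
  have hev (k : Fin (m + 2)) : ContDiffAt ℝ ∞ (fun y : Fin (m + 2) → ℂ => y k) x :=
    (contDiff_apply ℝ ℂ k).contDiffAt
  have hph (k) (hk : k ∈ others i j) :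
      ContDiffAt ℝ ∞ (fun y : Fin (m + 2) → ℂ => y k / (‖y k‖ : ℂ)) x := by
    have h1 : ContDiffAt ℝ ∞ (fun y : Fin (m + 2) → ℂ => (‖y k‖ : ℂ)) x :=
      Complex.ofRealCLM.contDiff.contDiffAt.comp x ((hev k).norm ℝ (hx k hk))
    simp only [div_eq_mul_inv]
    exact (hev k).mul (h1.inv (Complex.ofReal_ne_zero.2 (norm_ne_zero_iff.2 (hx k hk))))
  have hz (k) (hk : k ∈ others i j) (e : ℤ) :
      ContDiffAt ℝ ∞ (fun y : Fin (m + 2) → ℂ => (y k / (‖y k‖ : ℂ)) ^ e) x := by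
    have h0 : x k / (‖x k‖ : ℂ) ≠ 0 :=
      norm_ne_zero_iff.1 (by rw [norm_phase (hx k hk)]; exact one_ne_zero)
    cases e with
    | ofNat e => simpa using (hph k hk).pow e
    | negSucc e =>
      simp only [zpow_negSucc]
      exact ((hph k hk).pow (e + 1)).inv (pow_ne_zero _ h0)
  exact ((hev i).mul (contDiffAt_prod fun k hk => hz k hk _)).prodMk
    ((hev j).mul (contDiffAt_prod fun k hk => hz k hk _))

theorem contDiffAt_chartInv {z : ℂ × ℂ} (hz : z ∈ Δ.chartTarget i j) :
    ContDiffAt ℝ ∞ (Δ.chartInv i j) z := by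
  rw [contDiffAt_pi]
  intro k
  by_cases hi : k = i
  · simpa [chartInv, hi] using contDiff_fst.contDiffAt
  by_cases hj : k = j
  · have hi' : ¬ j = i := hj ▸ hi
    simpa [chartInv, hj, hi'] using contDiff_snd.contDiffAt
  simp only [chartInv, hi, hj, if_false]
  refine Complex.ofRealCLM.contDiff.contDiffAt.comp z (ContDiffAt.sqrt ?_ ?_)
  · refine ContDiff.contDiffAt ?_
    have h1 : ContDiff ℝ ∞ fun z : ℂ × ℂ => ‖z.1‖ ^ 2 := contDiff_fst.norm_sq ℝ
    have h2 : ContDiff ℝ ∞ fun z : ℂ × ℂ => ‖z.2‖ ^ 2 := contDiff_snd.norm_sq ℝ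
    unfold chartSq
    fun_prop
  · exact (hz k (mem_others.2 ⟨hi, hj⟩)).ne'

theorem isOpen_chartSource (i j : Fin (m + 2)) : IsOpen (Δ.chartSource i j) := by
  rw [← Δ.isOpenQuotientMap_proj.isQuotientMap.isOpen_preimage]
  have : Δ.proj ⁻¹' Δ.chartSource i j
      = ⋂ k : Fin (m + 2), {x : Δ.levelSet | k ∈ others i j → x.1 k ≠ 0} := by
    ext x; simp [proj_mem_chartSource]
  rw [this]
  refine isOpen_iInter_of_finite fun k => ?_
  by_cases hk : k ∈ others i j
  · simpa [hk] using isOpen_ne_fun ((continuous_apply k).comp continuous_subtype_val)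
      (continuous_const (y := (0 : ℂ)))
  · simp [hk]

theorem nonempty_levelSet : Nonempty Δ.levelSet := by
  obtain ⟨w, ⟨hw, -⟩, -⟩ := Δ.edge_nontrivial 0
  refine ⟨⟨fun k => (√(2 * (Δ.α k * w.1 + Δ.β k * w.2 - Δ.a k)) : ℂ),
    Δ.mem_levelSet_of w fun k => ?_⟩⟩
  rw [Complex.norm_real, Real.norm_eq_abs, sq_abs, Real.sq_sqrt]
  linarith [hw k]

open Classical in
/-- The chart of `M_Δ` at a pair of indices `i, j` for which `vᵢ, vⱼ` is an oriented basis. -/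
def basisChart (hd : Δ.det i j = 1) : OpenPartialHomeomorph Δ.ReducedSpace (ℂ × ℂ) where
  toFun := Δ.lift (fun x => Δ.chartFun i j x.1) (Δ.chartFun_smul hd)
  invFun z := if hz : z ∈ Δ.chartTarget i j then Δ.proj ⟨Δ.chartInv i j z, Δ.chartInv_mem hd hz⟩
    else Δ.proj (Classical.choice Δ.nonempty_levelSet)
  source := Δ.chartSource i j
  target := Δ.chartTarget i j
  map_source' p hp := by
    obtain ⟨x, rfl⟩ := Δ.isOpenQuotientMap_proj.surjective p
    exact Δ.chartFun_mem hd x.2 hp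
  map_target' z hz := by
    rw [dif_pos hz]
    exact Δ.chartInv_ne_zero hz
  left_inv' p hp := by
    obtain ⟨x, rfl⟩ := Δ.isOpenQuotientMap_proj.surjective p
    rw [lift_proj, dif_pos (Δ.chartFun_mem hd x.2 hp)]
    exact Δ.proj_chartInv_chartFun hd x hp
  right_inv' z hz := by
    rw [dif_pos hz, lift_proj]
    exact Δ.chartFun_chartInv (Δ.ne_of_det hd) hz
  open_source := Δ.isOpen_chartSource i j
  open_target := Δ.isOpen_chartTarget i j
  continuousOn_toFun := by
    rw [Δ.isOpenQuotientMap_proj.isQuotientMap.continuousOn_isOpen_iff (Δ.isOpen_chartSource i j)]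
    intro x hx
    refine ContinuousAt.continuousWithinAt ?_
    exact ContinuousAt.comp (g := Δ.chartFun i j) (f := Subtype.val)
      (Δ.contDiffAt_chartFun hx).continuousAt continuous_subtype_val.continuousAt
  continuousOn_invFun := by
    rw [continuousOn_iff_continuous_domRestrict]
    have h1 : Continuous fun z : Δ.chartTarget i j =>
        (⟨Δ.chartInv i j z, Δ.chartInv_mem hd z.2⟩ : Δ.levelSet) := by
      refine Continuous.subtype_mk (continuous_iff_continuousAt.2 fun z => ?_) _
      exact ContinuousAt.comp (g := Δ.chartInv i j) (f := Subtype.val)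
        (Δ.contDiffAt_chartInv z.2).continuousAt continuous_subtype_val.continuousAt
    refine (Δ.isOpenQuotientMap_proj.continuous.comp h1).congr fun z => ?_
    simp only [Function.comp_apply, Set.domRestrict_apply]
    rw [dif_pos z.2]

theorem basisChart_proj (hd : Δ.det i j = 1) (x : Δ.levelSet) :
    Δ.basisChart hd (Δ.proj x) = Δ.chartFun i j x.1 := rfl

theorem isQuotientChart_basisChart (hd : Δ.det i j = 1) :
    Δ.IsQuotientChart (Δ.basisChart hd) := by
  refine ⟨fun x hx => ⟨Δ.chartFun i j, Δ.contDiffAt_chartFun hx, Eventually.of_forall fun y => rfl⟩,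
    fun z hz => ⟨Δ.chartInv i j, Δ.contDiffAt_chartInv hz, ?_⟩⟩
  filter_upwards [(Δ.isOpen_chartTarget i j).mem_nhds hz] with z' hz'
  refine ⟨Δ.chartInv_mem hd hz', ?_⟩
  have hs : Δ.proj ⟨Δ.chartInv i j z', Δ.chartInv_mem hd hz'⟩ ∈ (Δ.basisChart hd).source :=
    Δ.chartInv_ne_zero hz'
  exact (Δ.basisChart hd).injOn hs ((Δ.basisChart hd).map_target hz')
    ((Δ.chartFun_chartInv (Δ.ne_of_det hd) hz').trans ((Δ.basisChart hd).right_inv hz').symm)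

end Chart

theorem det_succ (k : Fin (m + 1)) : Δ.det k.castSucc k.succ = 1 := by
  have h1 := Δ.ccw k.castSucc k.succ (Fin.castSucc_lt_succ)
  rcases Int.isUnit_iff.1 (Δ.delzant k) with h | h
  · exact h
  · omega

/-- Two edges that meet are consecutive. -/
theorem not_between {x : Fin (m + 2) → ℂ} (hx : x ∈ Δ.levelSet) {i k j : Fin (m + 2)}
    (hik : i < k) (hkj : k < j) (hi : x i = 0) : x j ≠ 0 := by
  intro hj
  have hi' := Δ.level_eq hx i
  have hj' := Δ.level_eq hx j
  have hk' := Δ.level_eq hx k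
  rw [hi, norm_zero] at hi'
  rw [hj, norm_zero] at hj'
  have c : (0 : ℝ) < Δ.α k * Δ.β j - Δ.β k * Δ.α j := by exact_mod_cast Δ.ccw k j hkj
  have d : (0 : ℝ) < Δ.α i * Δ.β k - Δ.β i * Δ.α k := by exact_mod_cast Δ.ccw i k hik
  have e : (0 : ℝ) < Δ.α i * Δ.β j - Δ.β i * Δ.α j := by exact_mod_cast Δ.ccw i j (hik.trans hkj)
  have hsq := sq_nonneg ‖x k‖
  set X := ‖x 0‖ ^ 2
  set Y := ‖x (Fin.last (m + 1))‖ ^ 2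
  have key : ∀ w : ℝ × ℝ, (∀ k, Δ.a k ≤ Δ.α k * w.1 + Δ.β k * w.2) →
      Δ.α k * w.1 + Δ.β k * w.2 = Δ.a k → w = (X / 2, Y / 2) := by
    intro w hw hwk
    have h1 := hw i
    have h2 := hw j
    have p1 : 0 ≤ (Δ.α k * Δ.β j - Δ.β k * Δ.α j : ℝ)
        * (Δ.α i * w.1 + Δ.β i * w.2 - Δ.a i) := mul_nonneg c.le (by linarith)
    have p2 : 0 ≤ (Δ.α i * Δ.β k - Δ.β i * Δ.α k : ℝ)
        * (Δ.α j * w.1 + Δ.β j * w.2 - Δ.a j) := mul_nonneg d.le (by linarith)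
    have p3 : 0 ≤ (Δ.α i * Δ.β j - Δ.β i * Δ.α j : ℝ) * ‖x k‖ ^ 2 := mul_nonneg e.le hsq
    have p4 : (Δ.α k * Δ.β j - Δ.β k * Δ.α j : ℝ) * (Δ.α i * w.1 + Δ.β i * w.2 - Δ.a i)
        + (Δ.α i * Δ.β k - Δ.β i * Δ.α k : ℝ) * (Δ.α j * w.1 + Δ.β j * w.2 - Δ.a j)
        = - ((Δ.α i * Δ.β j - Δ.β i * Δ.α j : ℝ) * ‖x k‖ ^ 2) / 2 := by
      linear_combination (Δ.α i * Δ.β j - Δ.β i * Δ.α j : ℝ) * (hwk + hk' / 2)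
        - (Δ.α k * Δ.β j - Δ.β k * Δ.α j : ℝ) * hi' / 2
        - (Δ.α i * Δ.β k - Δ.β i * Δ.α k : ℝ) * hj' / 2
    have q1 : Δ.α i * w.1 + Δ.β i * w.2 - Δ.a i = 0 := by
      have : (Δ.α k * Δ.β j - Δ.β k * Δ.α j : ℝ) * (Δ.α i * w.1 + Δ.β i * w.2 - Δ.a i) = 0 := by
        linarith
      exact (mul_eq_zero.1 this).resolve_left c.ne'
    have q2 : Δ.α j * w.1 + Δ.β j * w.2 - Δ.a j = 0 := by
      have : (Δ.α i * Δ.β k - Δ.β i * Δ.α k : ℝ) * (Δ.α j * w.1 + Δ.β j * w.2 - Δ.a j) = 0 := by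
        linarith
      exact (mul_eq_zero.1 this).resolve_left d.ne'
    ext
    · refine mul_left_cancel₀ e.ne' ?_
      linear_combination Δ.β j * (q1 + hi' / 2) - Δ.β i * (q2 + hj' / 2)
    · refine mul_left_cancel₀ e.ne' ?_
      linear_combination Δ.α i * (q2 + hj' / 2) - Δ.α j * (q1 + hi' / 2)
  obtain ⟨w, ⟨h1, h2⟩, w', ⟨h1', h2'⟩, hne⟩ := Δ.edge_nontrivial k
  exact hne ((key w h1 h2).trans (key w' h1' h2').symm)

theorem exists_chart (p : Δ.ReducedSpace) :
    ∃ k : Fin (m + 1), p ∈ Δ.chartSource k.castSucc k.succ := by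
  obtain ⟨x, rfl⟩ := Δ.isOpenQuotientMap_proj.surjective p
  by_cases h : ∃ i : Fin (m + 1), x.1 i.castSucc = 0
  · obtain ⟨i, hi, hmin⟩ := wellFounded_lt.has_min {i : Fin (m + 1) | x.1 i.castSucc = 0} h
    refine ⟨i, fun k hk => ?_⟩
    obtain ⟨h1, h2⟩ := mem_others.1 hk
    rcases lt_trichotomy k i.castSucc with hlt | heq | hgt
    · intro hk0
      obtain ⟨l, rfl⟩ : ∃ l : Fin (m + 1), l.castSucc = k :=
        ⟨k.castPred (ne_of_lt (hlt.trans_le (Fin.le_last _))), Fin.castSucc_castPred _ _⟩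
      exact hmin l hk0 (Fin.castSucc_lt_castSucc_iff.1 hlt)
    · exact absurd heq h1
    · refine Δ.not_between x.2 (k := i.succ) Fin.castSucc_lt_succ ?_ hi
      exact lt_of_le_of_ne (Fin.castSucc_lt_iff_succ_le.1 hgt) (Ne.symm h2)
  · refine ⟨Fin.last m, fun k hk => ?_⟩
    obtain ⟨h1, h2⟩ := mem_others.1 hk
    obtain ⟨l, rfl⟩ : ∃ l : Fin (m + 1), l.castSucc = k :=
      ⟨k.castPred (by simpa using h2), Fin.castSucc_castPred _ _⟩
    exact fun hk0 => h ⟨l, hk0⟩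

/-- The smooth structure of `M_Δ`: the atlas of all quotient charts. -/
instance : ChartedSpace (ℂ × ℂ) Δ.ReducedSpace where
  atlas := {e | Δ.IsQuotientChart e}
  chartAt p := Δ.basisChart (Δ.det_succ (Δ.exists_chart p).choose)
  mem_chart_source p := (Δ.exists_chart p).choose_spec
  chart_mem_atlas _ := Δ.isQuotientChart_basisChart _

instance : IsManifold 𝓘(ℝ, ℂ × ℂ) ∞ Δ.ReducedSpace := by
  refine isManifold_of_contDiffOn _ _ _ fun e e' he he' => ?_
  intro z hz
  simp only [modelWithCornersSelf_coe, modelWithCornersSelf_coe_symm, preimage_id, range_id,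
    inter_univ, OpenPartialHomeomorph.trans_source, OpenPartialHomeomorph.symm_source,
    mem_inter_iff, mem_preimage] at hz
  obtain ⟨hz1, hz2⟩ := hz
  refine ContDiffAt.contDiffWithinAt ?_
  obtain ⟨s, hs, hs'⟩ := he.2 z hz1
  obtain ⟨h0, h0'⟩ := hs'.self_of_nhds
  obtain ⟨f, hf, hf'⟩ := he'.1 ⟨s z, h0⟩ (h0' ▸ hz2)
  refine (ContDiffAt.comp z hf hs).congr_of_eventuallyEq ?_
  rw [nhds_subtype_eq_comap] at hf'
  obtain ⟨W, hW, hW'⟩ := eventually_comap.1 hf' |>.exists_mem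
  filter_upwards [hs', hs.continuousAt.preimage_mem_nhds hW] with z' hz' hzW
  obtain ⟨h1, h1'⟩ := hz'
  have := hW' _ hzW ⟨s z', h1⟩ rfl
  simpa [h1'] using this

/-! ### The reduced symplectic form -/

/-- The standard symplectic form `∑ₖ dxₖ ∧ dyₖ` on `ℂⁿ`. -/
def stdForm {ι : Type} [Fintype ι] (u v : ι → ℂ) : ℝ := ∑ k, (star (u k) * v k).im

/-- The standard symplectic form on `ℂ²`. -/
def stdForm₂ (u v : ℂ × ℂ) : ℝ := (star u.1 * v.1).im + (star u.2 * v.2).im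

/-- A smooth local section, near `p`, of the quotient map from the level set to `M_Δ`. -/
def IsLocalSection (p : Δ.ReducedSpace) (σ : Δ.ReducedSpace → Fin (m + 2) → ℂ) : Prop :=
  ContMDiffAt 𝓘(ℝ, ℂ × ℂ) 𝓘(ℝ, Fin (m + 2) → ℂ) ∞ σ p ∧
    ∀ᶠ q in 𝓝 p, ∃ h : σ q ∈ Δ.levelSet, Δ.proj ⟨σ q, h⟩ = q

theorem exists_isLocalSection (p : Δ.ReducedSpace) : ∃ σ, Δ.IsLocalSection p σ := by
  set e := chartAt (ℂ × ℂ) p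
  have he : Δ.IsQuotientChart e := chart_mem_atlas (ℂ × ℂ) p
  have hp : p ∈ e.source := mem_chart_source (ℂ × ℂ) p
  obtain ⟨s, hs, hs'⟩ := he.2 (e p) (e.map_source hp)
  refine ⟨s ∘ e, ?_, ?_⟩
  · exact ContMDiffAt.comp p hs.contMDiffAt (contMDiffAt_of_mem_maximalAtlas
      (IsManifold.chart_mem_maximalAtlas p) hp)
  · filter_upwards [(e.continuousAt hp).eventually hs', e.open_source.mem_nhds hp] with q hq hq'
    obtain ⟨h, h'⟩ := hq
    exact ⟨h, h'.trans (e.left_inv hq')⟩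

/-- The reduced symplectic form on `M_Δ`: the pull-back of the standard form by a smooth local
section of the quotient map (by any such section). -/
def reducedForm (p : Δ.ReducedSpace) (u v : TangentSpace 𝓘(ℝ, ℂ × ℂ) p) : ℝ :=
  stdForm (mfderiv 𝓘(ℝ, ℂ × ℂ) 𝓘(ℝ, Fin (m + 2) → ℂ) (Δ.exists_isLocalSection p).choose p u)
    (mfderiv 𝓘(ℝ, ℂ × ℂ) 𝓘(ℝ, Fin (m + 2) → ℂ) (Δ.exists_isLocalSection p).choose p v)

section PullBack

/-- The angular derivative `Im (z̄ w) / |z|²`. -/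
def dArg (z w : ℂ) : ℝ := (star z * w).im / ‖z‖ ^ 2

theorem hasDerivAt_norm_sq {g : ℝ → ℂ} {g' : ℂ} {t : ℝ} (hg : HasDerivAt g g' t) :
    HasDerivAt (fun s => ‖g s‖ ^ 2) (2 * (star (g t) * g').re) t := by
  have h := hg.norm_sq
  refine h.congr_deriv ?_
  simp [Complex.inner, mul_comm]

theorem hasDerivAt_phase {g : ℝ → ℂ} {g' : ℂ} {t : ℝ} (hg : HasDerivAt g g' t) (h0 : g t ≠ 0) :
    HasDerivAt (fun s => g s / (‖g s‖ : ℂ))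
      (g t / (‖g t‖ : ℂ) * (Complex.I * dArg (g t) g')) t := by
  have hn : ‖g t‖ ≠ 0 := norm_ne_zero_iff.2 h0
  have h1 : HasDerivAt (fun s => ‖g s‖) ((star (g t) * g').re / ‖g t‖) t := by
    have := (hasDerivAt_norm_sq hg).sqrt (pow_ne_zero 2 hn)
    simp only [Real.sqrt_sq (norm_nonneg _)] at this
    refine this.congr_deriv ?_
    field_simp
  have h2 := hg.div h1.ofReal_comp (Complex.ofReal_ne_zero.2 hn)
  refine h2.congr_deriv ?_
  have hn' : (‖g t‖ : ℂ) ≠ 0 := Complex.ofReal_ne_zero.2 hn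
  obtain ⟨q, hq⟩ : ∃ q, q = star (g t) * g' := ⟨_, rfl⟩
  have e : star (g t) * g' = (q.re : ℂ) + q.im * Complex.I := by
    rw [Complex.re_add_im, hq]
  have e2 : g t * star (g t) = (‖g t‖ : ℂ) ^ 2 := Complex.mul_conj' (g t)
  simp only [dArg, ← hq]
  push_cast
  field_simp
  linear_combination g t * e - g' * e2

theorem hasDerivAt_phase_zpow {g : ℝ → ℂ} {g' : ℂ} {t : ℝ} (hg : HasDerivAt g g' t)
    (h0 : g t ≠ 0) (e : ℤ) :
    HasDerivAt (fun s => (g s / (‖g s‖ : ℂ)) ^ e)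
      ((g t / (‖g t‖ : ℂ)) ^ e * (Complex.I * (e * dArg (g t) g' : ℝ))) t := by
  have hp : g t / (‖g t‖ : ℂ) ≠ 0 :=
    div_ne_zero h0 (Complex.ofReal_ne_zero.2 (norm_ne_zero_iff.2 h0))
  have h := (hasDerivAt_zpow e (g t / (‖g t‖ : ℂ)) (Or.inl hp)).comp t (hasDerivAt_phase hg h0)
  refine h.congr_deriv ?_
  rw [zpow_sub_one₀ hp]
  push_cast
  linear_combination (e * (g t / (‖g t‖ : ℂ)) ^ e * (Complex.I * dArg (g t) g'))
    * inv_mul_cancel₀ hp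

theorem hasDerivAt_prod_phase {ι : Type} [DecidableEq ι] (S : Finset ι) (e : ι → ℤ)
    {g : ℝ → ι → ℂ} {g' : ι → ℂ} {t : ℝ} (hg : ∀ k, HasDerivAt (fun s => g s k) (g' k) t)
    (h0 : ∀ k ∈ S, g t k ≠ 0) :
    HasDerivAt (fun s => ∏ k ∈ S, (g s k / (‖g s k‖ : ℂ)) ^ e k)
      ((∏ k ∈ S, (g t k / (‖g t k‖ : ℂ)) ^ e k)
        * (Complex.I * (∑ k ∈ S, e k * dArg (g t k) (g' k) : ℝ))) t := by
  induction S using Finset.induction_on with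
  | empty => simpa using hasDerivAt_const t (1 : ℂ)
  | insert k S hk ih =>
    have h1 := hasDerivAt_phase_zpow (hg k) (h0 k (Finset.mem_insert_self _ _)) (e k)
    have h2 := ih fun l hl => h0 l (Finset.mem_insert_of_mem hl)
    simp only [Finset.prod_insert hk, Finset.sum_insert hk]
    refine (h1.mul h2).congr_deriv ?_
    push_cast
    ring

variable {i j : Fin (m + 2)}

/-- The differential of the chart at `x` in the direction `y`. -/
theorem hasDerivAt_chartFun {g : ℝ → Fin (m + 2) → ℂ} {y : Fin (m + 2) → ℂ} {t : ℝ}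
    (hg : HasDerivAt g y t) (h0 : ∀ k ∈ others i j, g t k ≠ 0) :
    HasDerivAt (fun s => Δ.chartFun i j (g s))
      ((∏ k ∈ others i j, (g t k / (‖g t k‖ : ℂ)) ^ Δ.det k j) * (y i + g t i * (Complex.I *
          (∑ k ∈ others i j, Δ.det k j * dArg (g t k) (y k) : ℝ))),
        (∏ k ∈ others i j, (g t k / (‖g t k‖ : ℂ)) ^ Δ.det i k) * (y j + g t j * (Complex.I *
          (∑ k ∈ others i j, Δ.det i k * dArg (g t k) (y k) : ℝ)))) t := by
  have hg' := hasDerivAt_pi.1 hg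
  have h1 := (hg' i).mul (hasDerivAt_prod_phase (others i j) (fun k => Δ.det k j) hg' h0)
  have h2 := (hg' j).mul (hasDerivAt_prod_phase (others i j) (fun k => Δ.det i k) hg' h0)
  refine (h1.prodMk h2).congr_deriv ?_
  ext1 <;> ring

theorem im_star_mul_phase {P a b z : ℂ} (hP : ‖P‖ = 1) (A B : ℝ) :
    (star (P * (a + z * (Complex.I * A))) * (P * (b + z * (Complex.I * B)))).im
      = (star a * b).im + B * (star z * a).re - A * (star z * b).re := by
  have e : star P * P = 1 := by
    have := Complex.conj_mul' P
    rw [hP] at this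
    simpa using this
  have : star (P * (a + z * (Complex.I * A))) * (P * (b + z * (Complex.I * B)))
      = star (a + z * (Complex.I * A)) * (b + z * (Complex.I * B)) := by
    rw [star_mul]
    linear_combination star (a + z * (Complex.I * A)) * (b + z * (Complex.I * B)) * e
  rw [this]
  simp
  ring

theorem stdForm₂_chart (hd : Δ.det i j = 1) {x : Fin (m + 2) → ℂ}
    (h0 : ∀ k ∈ others i j, x k ≠ 0) {P Q : ℂ} (hP : ‖P‖ = 1) (hQ : ‖Q‖ = 1)
    {u v : Fin (m + 2) → ℂ}
    (hu : ∀ k, (star (x k) * u k).re = Δ.det k j * (star (x i) * u i).re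
      + Δ.det i k * (star (x j) * u j).re)
    (hv : ∀ k, (star (x k) * v k).re = Δ.det k j * (star (x i) * v i).re
      + Δ.det i k * (star (x j) * v j).re) :
    stdForm₂
      (P * (u i + x i * (Complex.I * (∑ k ∈ others i j, Δ.det k j * dArg (x k) (u k) : ℝ))),
        Q * (u j + x j * (Complex.I * (∑ k ∈ others i j, Δ.det i k * dArg (x k) (u k) : ℝ))))
      (P * (v i + x i * (Complex.I * (∑ k ∈ others i j, Δ.det k j * dArg (x k) (v k) : ℝ))),
        Q * (v j + x j * (Complex.I * (∑ k ∈ others i j, Δ.det i k * dArg (x k) (v k) : ℝ))))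
      = stdForm u v := by
  have hij := Δ.ne_of_det hd
  have hsum : stdForm u v = (star (u i) * v i).im + (star (u j) * v j).im
      + ∑ k ∈ others i j, (star (u k) * v k).im := by
    rw [stdForm]
    exact prod_others (X := Multiplicative ℝ) hij
      (fun k => Multiplicative.ofAdd (star (u k) * v k).im)
  have hk : ∑ k ∈ others i j, (star (u k) * v k).im = ∑ k ∈ others i j,
      ((Δ.det k j * (star (x i) * u i).re + Δ.det i k * (star (x j) * u j).re) * dArg (x k) (v k)
        - (Δ.det k j * (star (x i) * v i).re + Δ.det i k * (star (x j) * v j).re)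
          * dArg (x k) (u k)) := by
    refine Finset.sum_congr rfl fun k hk => ?_
    rw [← hu k, ← hv k, dArg, dArg]
    have hn : ‖x k‖ ^ 2 ≠ 0 := pow_ne_zero 2 (norm_ne_zero_iff.2 (h0 k hk))
    have hr : (star (x k) * u k).re * (star (x k) * v k).im
        - (star (x k) * v k).re * (star (x k) * u k).im
          = ‖x k‖ ^ 2 * (star (u k) * v k).im := by
      rw [← Complex.normSq_eq_norm_sq, Complex.normSq_apply]
      simp
      ring
    rw [eq_comm, ← mul_div_assoc, ← mul_div_assoc, ← sub_div, div_eq_iff hn, hr, mul_comm]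
  rw [stdForm₂, im_star_mul_phase hP, im_star_mul_phase hQ, hsum, hk]
  simp only [Finset.sum_mul, Finset.sum_sub_distrib, add_mul, Finset.sum_add_distrib]
  have e1 (c : ℝ) (e : Fin (m + 2) → ℤ) (w : Fin (m + 2) → ℂ) :
      ∑ k ∈ others i j, (e k * c * dArg (x k) (w k))
        = ∑ k ∈ others i j, (e k * dArg (x k) (w k) * c) :=
    Finset.sum_congr rfl fun k _ => by ring
  rw [e1, e1, e1, e1]
  ring

/-- On curves in the level set, the chart pulls the standard form of `ℂ²` back to the standard form
of `ℂⁿ`. -/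
theorem stdForm₂_chartFun (hd : Δ.det i j = 1) {g h : ℝ → Fin (m + 2) → ℂ}
    {x u v : Fin (m + 2) → ℂ} (hg : HasDerivAt g u 0) (hh : HasDerivAt h v 0)
    (hgx : g 0 = x) (hhx : h 0 = x) (hgU : ∀ᶠ s in 𝓝 (0 : ℝ), g s ∈ Δ.levelSet)
    (hhU : ∀ᶠ s in 𝓝 (0 : ℝ), h s ∈ Δ.levelSet) (h0 : ∀ k ∈ others i j, x k ≠ 0) :
    stdForm₂ (deriv (fun s => Δ.chartFun i j (g s)) 0) (deriv (fun s => Δ.chartFun i j (h s)) 0)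
      = stdForm u v := by
  have hP (e : Fin (m + 2) → ℤ) : ‖∏ k ∈ others i j, (x k / (‖x k‖ : ℂ)) ^ e k‖ = 1 := by
    rw [norm_prod]
    refine Finset.prod_eq_one fun k hk => ?_
    rw [norm_zpow, norm_phase (h0 k hk), one_zpow]
  have tang {g : ℝ → Fin (m + 2) → ℂ} {u : Fin (m + 2) → ℂ} (hg : HasDerivAt g u 0)
      (hgx : g 0 = x) (hgU : ∀ᶠ s in 𝓝 (0 : ℝ), g s ∈ Δ.levelSet) (k : Fin (m + 2)) :
      (star (x k) * u k).re = Δ.det k j * (star (x i) * u i).re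
        + Δ.det i k * (star (x j) * u j).re := by
    have hg' := hasDerivAt_pi.1 hg
    have d (k) := hasDerivAt_norm_sq (hg' k)
    have hl (k : Fin (m + 2)) : 2 * (star (x k) * u k).re = Δ.α k * (2 * (star (x 0) * u 0).re)
        + Δ.β k * (2 * (star (x (Fin.last (m + 1))) * u (Fin.last (m + 1))).re) := by
      have h1 := ((((d 0).const_mul (Δ.α k : ℝ)).add
        ((d (Fin.last (m + 1))).const_mul (Δ.β k : ℝ))).sub_const (2 * Δ.a k))
      have h2 := h1.congr_of_eventuallyEq (f₁ := fun s => ‖g s k‖ ^ 2)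
        (hgU.mono fun s hs => Δ.level_eq hs k)
      have := (d k).unique h2
      rwa [hgx] at this
    have hd' : (Δ.α i * Δ.β j - Δ.β i * Δ.α j : ℝ) = 1 := by exact_mod_cast hd
    have hk := hl k
    have hi := hl i
    have hj := hl j
    simp only [det]
    push_cast
    linear_combination hk / 2 - (Δ.α k * Δ.β j - Δ.β k * Δ.α j : ℝ) * hi / 2
      - (Δ.α i * Δ.β k - Δ.β i * Δ.α k : ℝ) * hj / 2 - (Δ.α k * (star (x 0) * u 0).re
        + Δ.β k * (star (x (Fin.last (m + 1))) * u (Fin.last (m + 1))).re) * hd'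
  rw [(Δ.hasDerivAt_chartFun hg (by rwa [hgx])).deriv,
    (Δ.hasDerivAt_chartFun hh (by rwa [hhx])).deriv, hgx, hhx]
  exact Δ.stdForm₂_chart hd h0 (hP _) (hP _) (tang hg hgx hgU) (tang hh hhx hhU)

/-- The reduced form `ω` is characterized by `π^* ω = ι^* ω₀`, where `π` is the quotient map and
`ι` is the inclusion of the level set in `ℂⁿ`: for every smooth map `c` into the level set,
`(π ∘ c)^* ω = (ι ∘ c)^* ω₀`. -/
theorem reducedForm_pullback {E : Type*} [NormedAddCommGroup E] [NormedSpace ℝ E]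
    {c : E → Δ.levelSet} {t : E} (hc : ContDiffAt ℝ ∞ (fun s => (c s).1) t) (u v : E) :
    Δ.reducedForm (Δ.proj (c t)) (mfderiv 𝓘(ℝ, E) 𝓘(ℝ, ℂ × ℂ) (fun s => Δ.proj (c s)) t u)
        (mfderiv 𝓘(ℝ, E) 𝓘(ℝ, ℂ × ℂ) (fun s => Δ.proj (c s)) t v) =
      stdForm (fderiv ℝ (fun s => (c s).1) t u) (fderiv ℝ (fun s => (c s).1) t v) := by
  have hcc : ContinuousAt c t :=
    Topology.IsInducing.subtypeVal.continuousAt_iff.2 hc.continuousAt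
  obtain ⟨k, hk⟩ := Δ.exists_chart (Δ.proj (c t))
  have hd := Δ.det_succ k
  have hf : ContMDiffAt 𝓘(ℝ, E) 𝓘(ℝ, ℂ × ℂ) ∞ (fun s => Δ.proj (c s)) t := by
    have he : Δ.basisChart hd ∈ IsManifold.maximalAtlas 𝓘(ℝ, ℂ × ℂ) ∞ Δ.ReducedSpace :=
      IsManifold.subset_maximalAtlas (Δ.isQuotientChart_basisChart hd)
    refine (contMDiffWithinAt_iff_target_of_mem_maximalAtlas (I := 𝓘(ℝ, E)) (x := t) (s := univ)
      (f := fun s => Δ.proj (c s)) he hk).2 ⟨?_, ?_⟩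
    · exact (Δ.isOpenQuotientMap_proj.continuous.continuousAt.comp hcc).continuousWithinAt
    · have := ContDiffAt.comp t (Δ.contDiffAt_chartFun (Δ.proj_mem_chartSource.1 hk)) hc
      exact this.contMDiffAt.contMDiffWithinAt
  obtain ⟨hσ, hσ'⟩ := (Δ.exists_isLocalSection (Δ.proj (c t))).choose_spec
  unfold reducedForm
  set σ := (Δ.exists_isLocalSection (Δ.proj (c t))).choose
  have hmf := hf.mdifferentiableAt (by simp)
  have hmσ := hσ.mdifferentiableAt (by simp)
  set τ : E → Fin (m + 2) → ℂ := fun s => σ (Δ.proj (c s)) with hτ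
  have hτd : DifferentiableAt ℝ τ t := (hmσ.comp t hmf).differentiableAt
  have hτu (u : E) : mfderiv 𝓘(ℝ, ℂ × ℂ) 𝓘(ℝ, Fin (m + 2) → ℂ) σ (Δ.proj (c t))
      (mfderiv 𝓘(ℝ, E) 𝓘(ℝ, ℂ × ℂ) (fun s => Δ.proj (c s)) t u) = fderiv ℝ τ t u := by
    have h := mfderiv_comp t (g := σ) (f := fun s => Δ.proj (c s)) hmσ hmf
    rw [← mfderiv_eq_fderiv]
    exact (congrArg (fun L => L u) h).symm
  have hev := hf.continuousAt.eventually hσ'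
  have hline (w : E) : Tendsto (fun s : ℝ => t + s • w) (𝓝 0) (𝓝 t) := by
    have : Continuous fun s : ℝ => t + s • w := by fun_prop
    simpa using this.tendsto 0
  have hcU (w : E) : ∀ᶠ s in 𝓝 (0 : ℝ), (c (t + s • w)).1 ∈ Δ.levelSet :=
    Eventually.of_forall fun s => (c _).2
  have hτU (w : E) : ∀ᶠ s in 𝓝 (0 : ℝ), τ (t + s • w) ∈ Δ.levelSet :=
    ((hline w).eventually hev).mono fun s hs => hs.1
  have heq : ∀ᶠ s in 𝓝 t, Δ.chartFun k.castSucc k.succ (τ s)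
      = Δ.chartFun k.castSucc k.succ (c s).1 := by
    filter_upwards [hev] with s hs
    obtain ⟨h, hp⟩ := hs
    exact congrArg (Δ.basisChart hd) hp
  have hder (w : E) : deriv (fun s : ℝ => Δ.chartFun k.castSucc k.succ (τ (t + s • w))) 0
      = deriv (fun s : ℝ => Δ.chartFun k.castSucc k.succ (c (t + s • w)).1) 0 :=
    Filter.EventuallyEq.deriv_eq ((hline w).eventually heq)
  have h0τ : ∀ l ∈ others k.castSucc k.succ, τ t l ≠ 0 := by
    obtain ⟨h, hp⟩ := hev.self_of_nhds
    have : Δ.proj ⟨τ t, h⟩ ∈ Δ.chartSource k.castSucc k.succ := by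
      rw [show Δ.proj ⟨τ t, h⟩ = Δ.proj (c t) from hp]
      exact hk
    exact this
  have lτ (w : E) : HasDerivAt (fun s : ℝ => τ (t + s • w)) (fderiv ℝ τ t w) 0 :=
    hτd.hasFDerivAt.hasLineDerivAt w
  have lc (w : E) : HasDerivAt (fun s : ℝ => (c (t + s • w)).1)
      (fderiv ℝ (fun s => (c s).1) t w) 0 :=
    (hc.differentiableAt (by simp)).hasFDerivAt.hasLineDerivAt w
  have h1 := Δ.stdForm₂_chartFun hd (x := τ t) (lτ u) (lτ v) (by simp) (by simp)
    (hτU u) (hτU v) h0τ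
  have h2 := Δ.stdForm₂_chartFun hd (x := (c t).1) (lc u) (lc v) (by simp) (by simp)
    (hcU u) (hcU v) hk
  rw [hder, hder] at h1
  rw [hτu, hτu, ← h1, h2]

end PullBack

end DelzantCorner

end

/-!
The map `ψ` is one of the charts of the reduced space.  The normals `v₁ = (1, 0)` and
`vₙ = (0, 1)` form an oriented basis of `ℤ²`, and `det (v_k, vₙ) = α_k`, `det (v₁, v_k) = β_k`, so
`basisChart` at the indices `1, n` is given by
`[x] ↦ (x₁ ∏ (x_k / |x_k|) ^ α_k, xₙ ∏ (x_k / |x_k|) ^ β_k)`, which is the formula for `ψ`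
(`chartFun_zero_last`).  Its source is the complement of the chain of spheres, because on the level
set `½ |x_k|² = ⟨Φ([x]), v_k⟩ - a_k` (`mem_chartSource_zero_last`), and its target is the open set
of the statement (`mem_chartTarget_zero_last`).  A chart of the smooth structure is a diffeomorphism
from its source onto its target (`OpenPartialHomeomorph.toDiffeomorphOpens`).

Each such chart carries the reduced form to the standard form of `ℂ²`
(`stdForm₂_mfderiv_basisChart`): for a local section `σ` of the quotient map, the map `σ ∘ e⁻¹` is
right inverse to the formula of the chart `e` on the level set, and that formula pulls the standard
form of `ℂ²` back to the standard form of `ℂⁿ`.  Equivariance and the intertwining of the moment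
maps are read off from the formula.
-/

section OpenPartialHomeomorph

open TopologicalSpace (Opens)

variable {𝕜 : Type*} [NontriviallyNormedField 𝕜] {E : Type*} [NormedAddCommGroup E]
  [NormedSpace 𝕜 E] {M : Type*} [TopologicalSpace M] [ChartedSpace E M]

/-- An element of the maximal atlas is a diffeomorphism from its source onto its target, both
regarded as open submanifolds.  The source and the target are given as bundled open sets `U` and
`V` with the same members, so that they may have a description of their own. -/
def OpenPartialHomeomorph.toDiffeomorphOpens [IsManifold 𝓘(𝕜, E) ∞ M]
    (e : OpenPartialHomeomorph M E) (he : e ∈ IsManifold.maximalAtlas 𝓘(𝕜, E) ∞ M)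
    (U : Opens M) (V : Opens E) (hU : ∀ p, p ∈ U ↔ p ∈ e.source)
    (hV : ∀ z, z ∈ V ↔ z ∈ e.target) : Diffeomorph 𝓘(𝕜, E) 𝓘(𝕜, E) U V ∞ where
  toFun p := ⟨e p, (hV _).2 (e.map_source ((hU _).1 p.2))⟩
  invFun z := ⟨e.symm z, (hU _).2 (e.map_target ((hV _).1 z.2))⟩
  left_inv p := Subtype.ext (e.left_inv ((hU _).1 p.2))
  right_inv z := Subtype.ext (e.right_inv ((hV _).1 z.2))
  contMDiff_toFun := by
    refine (ContMDiff.subtypeVal_comp_iff V _).1 fun p => ?_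
    exact (contMDiffAt_subtype_iff (f := e)).2 (contMDiffAt_of_mem_maximalAtlas he ((hU _).1 p.2))
  contMDiff_invFun := by
    refine (ContMDiff.subtypeVal_comp_iff U _).1 fun z => ?_
    exact (contMDiffAt_subtype_iff (f := e.symm)).2
      (contMDiffAt_symm_of_mem_maximalAtlas he ((hV _).1 z.2))

end OpenPartialHomeomorph

namespace DelzantCorner

variable {m : ℕ} (Δ : DelzantCorner m)

theorem det_last_right (k : Fin (m + 2)) : Δ.det k (Fin.last (m + 1)) = Δ.α k := by
  simp [det, Δ.α_last, Δ.β_last]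

theorem det_zero_left (k : Fin (m + 2)) : Δ.det 0 k = Δ.β k := by
  simp [det, Δ.α_first, Δ.β_first]

theorem det_zero_last : Δ.det 0 (Fin.last (m + 1)) = 1 := by
  rw [det_last_right, Δ.α_first]

theorem mid_mem_others (i : Fin m) : mid i ∈ others 0 (Fin.last (m + 1)) := by
  simp [mem_others, mid, Fin.ext_iff, i.2.ne]

theorem forall_mem_others {P : Fin (m + 2) → Prop} :
    (∀ k ∈ others 0 (Fin.last (m + 1)), P k) ↔ ∀ i : Fin m, P (mid i) := by
  refine ⟨fun h i => h _ (mid_mem_others i), fun h => ?_⟩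
  refine forall_index (by simp [mem_others]) (by simp [mem_others]) fun i _ => h i

theorem prod_others_zero_last {X : Type*} [CommMonoid X] (f : Fin (m + 2) → X) :
    ∏ k ∈ others 0 (Fin.last (m + 1)), f k = ∏ i : Fin m, f (mid i) := by
  symm
  refine Finset.prod_bij (fun i _ => mid i) (fun i _ => mid_mem_others i) ?_ ?_ fun _ _ => rfl
  · intro i _ j _ h
    simpa [mid] using h
  · exact forall_mem_others.2 fun i => ⟨i, Finset.mem_univ i, rfl⟩

theorem prod_phase_zpow {ι : Type*} (s : Finset ι) (x : ι → ℂ) (e : ι → ℤ) :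
    ∏ k ∈ s, (x k / (‖x k‖ : ℂ)) ^ e k = (∏ k ∈ s, x k ^ e k) / (‖∏ k ∈ s, x k ^ e k‖ : ℂ) := by
  simp only [norm_prod, norm_zpow, Complex.ofReal_prod, Complex.ofReal_zpow, div_zpow,
    Finset.prod_div_distrib]

/-- The formula of the chart at the first and last indices. -/
theorem chartFun_zero_last (x : Fin (m + 2) → ℂ) :
    Δ.chartFun 0 (Fin.last (m + 1)) x =
      ((x 0 * ∏ i : Fin m, x (mid i) ^ Δ.α (mid i)) /
          (‖∏ i : Fin m, x (mid i) ^ Δ.α (mid i)‖ : ℂ),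
        ((∏ i : Fin m, x (mid i) ^ Δ.β (mid i)) * x (Fin.last (m + 1))) /
          (‖∏ i : Fin m, x (mid i) ^ Δ.β (mid i)‖ : ℂ)) := by
  simp only [chartFun, det_last_right, det_zero_left, prod_others_zero_last]
  rw [prod_phase_zpow _ (fun i => x (mid i)), prod_phase_zpow _ (fun i => x (mid i)),
    ← mul_div_assoc, ← mul_div_assoc, mul_comm (x (Fin.last (m + 1)))]

theorem proj_mem_sphere_iff (x : Δ.levelSet) (k : Fin (m + 2)) :
    Δ.proj x ∈ Δ.sphere k ↔ x.1 k = 0 := by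
  have h := Δ.level_eq x.2 k
  rw [← norm_eq_zero, ← sq_eq_zero_iff, h]
  simp only [sphere, momentMap, mem_ofPred_eq, lift_proj]
  constructor <;> intro h' <;> linarith

/-- The complement of the chain of spheres is the domain of the chart at the first and last
indices. -/
theorem mem_chartSource_zero_last (p : Δ.ReducedSpace) :
    p ∈ Δ.chainCompl ↔ p ∈ Δ.chartSource 0 (Fin.last (m + 1)) := by
  obtain ⟨x, rfl⟩ := Δ.isOpenQuotientMap_proj.surjective p
  rw [proj_mem_chartSource, forall_mem_others, ← SetLike.mem_coe]
  simp [chainCompl, chain, proj_mem_sphere_iff]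

/-- The open set `blowupTarget` is the image of the chart at the first and last indices. -/
theorem mem_chartTarget_zero_last (z : ℂ × ℂ) :
    z ∈ Δ.blowupTarget ↔ z ∈ Δ.chartTarget 0 (Fin.last (m + 1)) := by
  have h : z ∈ Δ.blowupTarget ↔ ∀ i : Fin m, (1 / 2 : ℝ) * (‖z.1‖ ^ 2 * Δ.α (mid i)
      + ‖z.2‖ ^ 2 * Δ.β (mid i)) > Δ.a (mid i) := mem_iInter
  rw [h]
  unfold chartTarget
  rw [mem_ofPred_eq, forall_mem_others]
  refine forall_congr' fun i => ?_
  simp only [chartSq, det_last_right, det_zero_left, Δ.a_first, Δ.a_last]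
  constructor <;> intro h' <;> linarith

theorem basisChart_mem_maximalAtlas {i j : Fin (m + 2)} (hd : Δ.det i j = 1) :
    Δ.basisChart hd ∈ IsManifold.maximalAtlas 𝓘(ℝ, ℂ × ℂ) ∞ Δ.ReducedSpace :=
  IsManifold.subset_maximalAtlas (Δ.isQuotientChart_basisChart hd)

/-- The charts `basisChart` are Darboux charts: they carry the reduced form to the standard form
of `ℂ²`. -/
theorem stdForm₂_mfderiv_basisChart {i j : Fin (m + 2)} (hd : Δ.det i j = 1) {p : Δ.ReducedSpace}
    (hp : p ∈ Δ.chartSource i j) (u v : TangentSpace 𝓘(ℝ, ℂ × ℂ) p) :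
    stdForm₂ (mfderiv 𝓘(ℝ, ℂ × ℂ) 𝓘(ℝ, ℂ × ℂ) (Δ.basisChart hd) p u)
        (mfderiv 𝓘(ℝ, ℂ × ℂ) 𝓘(ℝ, ℂ × ℂ) (Δ.basisChart hd) p v) = Δ.reducedForm p u v := by
  obtain ⟨hσ, hσ'⟩ := (Δ.exists_isLocalSection p).choose_spec
  unfold reducedForm
  set σ := (Δ.exists_isLocalSection p).choose
  set e := Δ.basisChart hd
  have hpe : p ∈ e.source := hp
  have hz : e p ∈ e.target := e.map_source hpe
  have he := Δ.basisChart_mem_maximalAtlas hd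
  have hmσ := hσ.mdifferentiableAt (by simp)
  have hme : MDifferentiableAt 𝓘(ℝ, ℂ × ℂ) 𝓘(ℝ, ℂ × ℂ) e p :=
    (contMDiffAt_of_mem_maximalAtlas he hpe).mdifferentiableAt (by simp)
  have hms : MDifferentiableAt 𝓘(ℝ, ℂ × ℂ) 𝓘(ℝ, ℂ × ℂ) e.symm (e p) :=
    (contMDiffAt_symm_of_mem_maximalAtlas he hz).mdifferentiableAt (by simp)
  -- The section `σ`, written in the chart.
  set τ : ℂ × ℂ → Fin (m + 2) → ℂ := σ ∘ e.symm with hτ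
  have hmτ : MDifferentiableAt 𝓘(ℝ, ℂ × ℂ) 𝓘(ℝ, Fin (m + 2) → ℂ) τ (e p) :=
    MDifferentiableAt.comp (e p) ((e.left_inv hpe).symm ▸ hmσ) hms
  have hτd : DifferentiableAt ℝ τ (e p) := hmτ.differentiableAt
  have hστ : σ =ᶠ[𝓝 p] τ ∘ e := by
    filter_upwards [e.open_source.mem_nhds hpe] with q hq
    simp only [hτ, Function.comp_apply, e.left_inv hq]
  have hdσ (w : TangentSpace 𝓘(ℝ, ℂ × ℂ) p) :
      mfderiv 𝓘(ℝ, ℂ × ℂ) 𝓘(ℝ, Fin (m + 2) → ℂ) σ p w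
        = fderiv ℝ τ (e p) (mfderiv 𝓘(ℝ, ℂ × ℂ) 𝓘(ℝ, ℂ × ℂ) e p w) := by
    rw [hστ.mfderiv_eq, mfderiv_comp p hmτ hme, mfderiv_eq_fderiv]
    rfl
  rw [hdσ, hdσ]
  have hsymm : Tendsto e.symm (𝓝 (e p)) (𝓝 p) := by
    simpa only [e.left_inv hpe] using (e.continuousAt_symm hz).tendsto
  have hev := hsymm.eventually hσ'
  have hτU : ∀ᶠ z in 𝓝 (e p), τ z ∈ Δ.levelSet := hev.mono fun z h => h.1
  have hτe : ∀ᶠ z in 𝓝 (e p), Δ.chartFun i j (τ z) = z := by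
    filter_upwards [hev, e.open_target.mem_nhds hz] with z h hzt
    obtain ⟨h, hq⟩ := h
    exact (congrArg e hq).trans (e.right_inv hzt)
  have h0 : ∀ k ∈ others i j, τ (e p) k ≠ 0 := by
    obtain ⟨h, hq⟩ := hev.self_of_nhds
    have hq' : Δ.proj ⟨τ (e p), h⟩ = p := hq.trans (e.left_inv hpe)
    exact Δ.proj_mem_chartSource.1 (hq' ▸ hp)
  have hline (w : ℂ × ℂ) : Tendsto (fun s : ℝ => e p + s • w) (𝓝 0) (𝓝 (e p)) := by
    have : Continuous fun s : ℝ => e p + s • w := by fun_prop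
    simpa using this.tendsto 0
  have lτ (w : ℂ × ℂ) : HasDerivAt (fun s : ℝ => τ (e p + s • w)) (fderiv ℝ τ (e p) w) 0 :=
    hτd.hasFDerivAt.hasLineDerivAt w
  have hder (w : ℂ × ℂ) : deriv (fun s : ℝ => Δ.chartFun i j (τ (e p + s • w))) 0 = w := by
    have h : (fun s : ℝ => Δ.chartFun i j (τ (e p + s • w))) =ᶠ[𝓝 0] fun s => e p + s • w :=
      (hline w).eventually hτe
    rw [h.deriv_eq]
    simpa using (((hasDerivAt_id (0 : ℝ)).smul_const w).const_add (e p)).deriv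
  -- The curves `s ↦ τ (e p + s • w)` stay in the level set, and the chart maps them to straight lines
  -- of direction `w`, so the comparison of the two forms along curves applies to them.
  have key (a b : ℂ × ℂ) :
      stdForm₂ a b = stdForm (fderiv ℝ τ (e p) a) (fderiv ℝ τ (e p) b) := by
    have := Δ.stdForm₂_chartFun hd (x := τ (e p)) (lτ a) (lτ b) (by simp) (by simp)
      ((hline a).eventually hτU) ((hline b).eventually hτU) h0
    rwa [hder, hder] at this
  exact key _ _

end DelzantCorner

theorem mainTheorem6 (m : ℕ) (Δ : DelzantCorner m) :
    ∃ ψ : Diffeomorph 𝓘(ℝ, ℂ × ℂ) 𝓘(ℝ, ℂ × ℂ) Δ.chainCompl Δ.blowupTarget ∞,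
      (∀ (x : Δ.levelSet) (hx : Δ.proj x ∈ Δ.chainCompl),
        (∀ i : Fin m, x.1 (DelzantCorner.mid i) ≠ 0) ∧
        (ψ ⟨Δ.proj x, hx⟩ : ℂ × ℂ) =
          ((x.1 0 * ∏ i : Fin m, x.1 (DelzantCorner.mid i) ^ Δ.α (DelzantCorner.mid i)) /
              (‖∏ i : Fin m, x.1 (DelzantCorner.mid i) ^ Δ.α (DelzantCorner.mid i)‖ : ℂ),
            ((∏ i : Fin m, x.1 (DelzantCorner.mid i) ^ Δ.β (DelzantCorner.mid i)) *
                x.1 (Fin.last (m + 1))) /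
              (‖∏ i : Fin m, x.1 (DelzantCorner.mid i) ^ Δ.β (DelzantCorner.mid i)‖ : ℂ))) ∧
      (∀ (t : Circle × Circle) (p : Δ.chainCompl), ∃ h : t • p.1 ∈ Δ.chainCompl,
        (ψ ⟨t • p.1, h⟩ : ℂ × ℂ) =
          ((t.1 : ℂ) * (ψ p : ℂ × ℂ).1, (t.2 : ℂ) * (ψ p : ℂ × ℂ).2)) ∧
      (∀ (p : Δ.chainCompl) (u v : TangentSpace 𝓘(ℝ, ℂ × ℂ) p),
        DelzantCorner.stdForm₂
            (mfderiv 𝓘(ℝ, ℂ × ℂ) 𝓘(ℝ, ℂ × ℂ) (fun q : Δ.chainCompl => (ψ q : ℂ × ℂ)) p u)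
            (mfderiv 𝓘(ℝ, ℂ × ℂ) 𝓘(ℝ, ℂ × ℂ) (fun q : Δ.chainCompl => (ψ q : ℂ × ℂ)) p v) =
          Δ.reducedForm p.1
            (mfderiv 𝓘(ℝ, ℂ × ℂ) 𝓘(ℝ, ℂ × ℂ) (fun q : Δ.chainCompl => q.1) p u)
            (mfderiv 𝓘(ℝ, ℂ × ℂ) 𝓘(ℝ, ℂ × ℂ) (fun q : Δ.chainCompl => q.1) p v)) ∧
      (∀ p : Δ.chainCompl,
        ((1 / 2 : ℝ) * ‖(ψ p : ℂ × ℂ).1‖ ^ 2, (1 / 2 : ℝ) * ‖(ψ p : ℂ × ℂ).2‖ ^ 2) =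
          Δ.momentMap p.1) := by
  set hd := Δ.det_zero_last
  refine ⟨(Δ.basisChart hd).toDiffeomorphOpens (Δ.basisChart_mem_maximalAtlas hd) Δ.chainCompl
    Δ.blowupTarget Δ.mem_chartSource_zero_last Δ.mem_chartTarget_zero_last, ?_, ?_, ?_, ?_⟩
  · intro x hx
    exact ⟨DelzantCorner.forall_mem_others.1 ((Δ.mem_chartSource_zero_last _).1 hx),
      Δ.chartFun_zero_last x.1⟩
  · rintro t ⟨p, hp⟩
    obtain ⟨x, rfl⟩ := Δ.isOpenQuotientMap_proj.surjective p
    have hx := DelzantCorner.forall_mem_others.1 ((Δ.mem_chartSource_zero_last _).1 hp)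
    have hmid (i : Fin m) :
        (Δ.torusMul t x).1 (DelzantCorner.mid i) = x.1 (DelzantCorner.mid i) := by
      have := DelzantCorner.mem_others.1 (DelzantCorner.mid_mem_others i)
      simp [DelzantCorner.torusMul, this]
    have h0 : (Δ.torusMul t x).1 0 = t.1 * x.1 0 := by simp [DelzantCorner.torusMul]
    have h1 : (Δ.torusMul t x).1 (Fin.last (m + 1)) = t.2 * x.1 (Fin.last (m + 1)) := by
      simp [DelzantCorner.torusMul]
    refine ⟨(Δ.mem_chartSource_zero_last (Δ.proj (Δ.torusMul t x))).2
      (DelzantCorner.forall_mem_others.2 fun i => (hmid i).symm ▸ hx i), ?_⟩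
    change Δ.chartFun 0 (Fin.last (m + 1)) (Δ.torusMul t x).1 =
      (t.1 * (Δ.chartFun 0 (Fin.last (m + 1)) x.1).1,
        t.2 * (Δ.chartFun 0 (Fin.last (m + 1)) x.1).2)
    simp only [Δ.chartFun_zero_last, hmid, h0, h1]
    ext1 <;> ring
  · intro p u v
    -- As a map to `ℂ²`, `ψ` is the chart composed with the inclusion of the open set.
    have hp := (Δ.mem_chartSource_zero_last _).1 p.2
    have hval : MDifferentiableAt 𝓘(ℝ, ℂ × ℂ) 𝓘(ℝ, ℂ × ℂ)
        (fun q : Δ.chainCompl => q.1) p :=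
      (contMDiff_subtype_val (n := ∞)).mdifferentiable (by simp) p
    have he : MDifferentiableAt 𝓘(ℝ, ℂ × ℂ) 𝓘(ℝ, ℂ × ℂ) (Δ.basisChart hd) p.1 :=
      (contMDiffAt_of_mem_maximalAtlas (Δ.basisChart_mem_maximalAtlas hd) hp).mdifferentiableAt
        (by simp)
    have hcomp := mfderiv_comp p he hval
    rw [← Δ.stdForm₂_mfderiv_basisChart hd hp]
    exact congrArg (fun L => DelzantCorner.stdForm₂ (L u) (L v)) hcomp
  · rintro ⟨p, hp⟩
    obtain ⟨x, rfl⟩ := Δ.isOpenQuotientMap_proj.surjective p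
    obtain ⟨h0, h1⟩ := Δ.norm_chartFun (i := 0) (j := Fin.last (m + 1))
      ((Δ.mem_chartSource_zero_last _).1 hp)
    change _ = ((1 / 2 : ℝ) * ‖x.1 0‖ ^ 2, (1 / 2 : ℝ) * ‖x.1 (Fin.last (m + 1))‖ ^ 2)
    rw [← h0, ← h1]
    rfl
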